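/- Let $(R,\mathfrak m,k)$ be a commutative noetherian local ring that is Cohen–Macaulay, is not Gorenstein, and has minimal multiplicity, that is, $\mathrm e(R)=\operatorname{edim}R-\dim R+1$, where $\mathrm e(R)=\lim_{n\to\infty} d!\,\ell_R(R/\mathfrak m^n)/n^d$ with $d=\dim R$ is the multiplicity of $R$ and $\operatorname{edim}R=\dim_k \mathfrak m/\mathfrak m^2$ is its embedding dimension. Assume that the residue field $k$ is infinite. Let $M$ be a finitely generated $R$-module of infinite projective dimension. Then $k$ belongs to $\operatorname{thick}_{\operatorname{mod}R}\{R,M\}$. Here $\operatorname{mod}R$ is the category of finitely generated $R$-modules. A full subcategory $\mathcal X$ of $\operatorname{mod}R$ that is closed under isomorphism is called thick if it is closed under direct summands and, for every short exact sequence $0\to L\to M'\to N\to 0$ in $\operatorname{mod}R$ with two of $L,M',N$ in $\mathcal X$, the third is in $\mathcal X$ as well; $\operatorname{thick}_{\operatorname{mod}R}\{R,M\}$ is the smallest thick subcategory of $\operatorname{mod}R$ containing $R$ and $M$. -/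

import Mathlib

open CategoryTheory

universe u

noncomputable section

/-! ### Invariants of noetherian local rings -/

namespace LocalAlgebra

section

variable (R : Type u) [CommRing R] [IsLocalRing R]

open IsLocalRing

/-- The depth of a local ring: the supremum of the lengths of the regular sequences contained in
the maximal ideal. -/
def depth : ℕ∞ :=
  ⨆ (rs : List R) (_ : RingTheory.Sequence.IsRegular R rs ∧ ∀ r ∈ rs, r ∈ maximalIdeal R),
    (rs.length : ℕ∞)

/-- A (noetherian) local ring is Cohen-Macaulay if its depth equals its Krull dimension. -/
def IsCohenMacaulay : Prop :=
  (depth R : WithBot ℕ∞) = ringKrullDim R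

/-- A (noetherian) local ring is Gorenstein if it has finite injective dimension as a module over
itself. -/
def IsGorenstein : Prop :=
  injectiveDimension (ModuleCat.of R R) ≠ ⊤

/-- The embedding dimension: the dimension of `𝔪 / 𝔪²` over the residue field. -/
def embDim : ℕ :=
  Module.finrank (ResidueField R) (CotangentSpace R)

/-- The Hilbert-Samuel function `n ↦ ℓ(R / 𝔪ⁿ)`. For a noetherian local ring all these lengths are
finite, so that `ENat.toNat` loses nothing. -/
def hilbertSamuel (n : ℕ) : ℕ :=
  (Module.length R (R ⧸ (maximalIdeal R) ^ n)).toNat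

/-- `HasMultiplicity R e` says that `e` is the (Hilbert-Samuel) multiplicity of the noetherian
local ring `R`, i.e. `lim_{n → ∞} d! ℓ(R / 𝔪ⁿ) / n ^ d = e`, where `d = dim R`. -/
def HasMultiplicity (e : ℝ) : Prop :=
  ∃ d : ℕ, ringKrullDim R = d ∧
    Filter.Tendsto (fun n : ℕ => (d.factorial : ℝ) * (hilbertSamuel R n : ℝ) / (n : ℝ) ^ d)
      Filter.atTop (nhds e)

/-- Minimal multiplicity: `e(R) = edim R - dim R + 1`. (Used for Cohen-Macaulay local rings.) -/
def HasMinimalMultiplicity : Prop :=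
  ∃ d : ℕ, ringKrullDim R = d ∧ HasMultiplicity R ((embDim R : ℝ) - (d : ℝ) + 1)

end

end LocalAlgebra

/-! ### Thick subcategories of abelian categories -/

namespace ThickSubcategory

variable {C : Type*} [Category* C] [Abelian C]

/-- A full subcategory of an abelian category (given by a property of objects) is thick if it is
closed under direct summands (in particular under isomorphisms) and, for each short exact sequence
`0 ⟶ X₁ ⟶ X₂ ⟶ X₃ ⟶ 0`, contains all three terms as soon as it contains two of them. -/
structure IsThick (P : ObjectProperty C) : Prop where
  of_retract : ∀ ⦃X Y : C⦄, Retract X Y → P Y → P X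
  left : ∀ ⦃S : ShortComplex C⦄, S.ShortExact → P S.X₂ → P S.X₃ → P S.X₁
  middle : ∀ ⦃S : ShortComplex C⦄, S.ShortExact → P S.X₁ → P S.X₃ → P S.X₂
  right : ∀ ⦃S : ShortComplex C⦄, S.ShortExact → P S.X₁ → P S.X₂ → P S.X₃

/-- The thick closure of `P`: the smallest thick subcategory containing `P`, i.e. the intersection
of all thick subcategories containing `P`. -/
def thickClosure (P : ObjectProperty C) : ObjectProperty C :=
  fun X => ∀ Q : ObjectProperty C, IsThick Q → P ≤ Q → Q X

theorem le_thickClosure (P : ObjectProperty C) : P ≤ thickClosure P :=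
  fun X hX _ _ hPQ => hPQ X hX

theorem isThick_thickClosure (P : ObjectProperty C) : IsThick (thickClosure P) where
  of_retract _ _ r h Q hQ hPQ := hQ.of_retract r (h Q hQ hPQ)
  left _ hS h₂ h₃ Q hQ hPQ := hQ.left hS (h₂ Q hQ hPQ) (h₃ Q hQ hPQ)
  middle _ hS h₁ h₃ Q hQ hPQ := hQ.middle hS (h₁ Q hQ hPQ) (h₃ Q hQ hPQ)
  right _ hS h₁ h₂ Q hQ hPQ := hQ.right hS (h₁ Q hQ hPQ) (h₂ Q hQ hPQ)

end ThickSubcategory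

end

/-! Minimal multiplicity enters only through a regular sequence `rs` in `𝔪` with `𝔪² ⊆ (rs)`. Since
`k` is infinite, `rs` can be chosen superficial of length `d = dim R`. Pascal's rule then gives
`ℓ(R/(rs)) * k.choose d ≤ ℓ(R/𝔪^(N+k))` for some `N` and all `k`, hence `ℓ(R/(rs)) ≤ e(R) = edim R -
d + 1`. As `ℓ(R/𝔪²) = edim R + 1`, and killing an element of `𝔪` in a quotient of `R/𝔪²` costs
length at most one, `ℓ(R/(rs)) ≤ ℓ(R/(𝔪² + (rs)))`, which forces `𝔪² ⊆ (rs)`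
(`exists_isWeaklyRegular_maximalIdeal_sq_le`).

Next, `M` is replaced by a high syzygy `N`, still of infinite projective dimension and in the thick
closure, on which `rs` is regular. Let `K ⊆ 𝔪F` be the kernel of a minimal free cover `F → N`. Then
`K ≠ 0`, `rs` is regular on `K`, and `K/(rs)K` embeds in `F/(rs)F`. There the image of `𝔪K` lies in
that of `𝔪²F ⊆ (rs)F`, so it vanishes. Thus `K/(rs)K` is a nonzero `k`-vector space in the thick
closure, and `k` is a direct summand of it (`IsThick.residueField_mem`). -/

/-! ### Superficial elements -/

noncomputable section

open IsLocalRing Polynomial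

/-- A finitely generated module over a local ring with infinite residue field is not a finite union
of proper submodules. -/
theorem IsLocalRing.exists_notMem_of_ne_top {R N : Type*} [CommRing R] [IsLocalRing R]
    [Infinite (ResidueField R)] [AddCommGroup N] [Module R N] [Module.Finite R N]
    (s : Set (Submodule R N)) (hfin : s.Finite) (hs : ∀ p ∈ s, p ≠ ⊤) :
    ∃ x : N, ∀ p ∈ s, x ∉ p := by
  by_contra! hx
  have hcover : ⋃ p ∈ hfin.toFinset, (id p : Set N) = Set.univ :=
    Set.eq_univ_of_forall fun x => by simpa using hx x
  -- B. H. Neumann's lemma: some member of a finite cover has finite index. The finite module `N ⧸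
  -- p` would then surject onto a nonzero vector space over an infinite field.
  obtain ⟨p, hp, hfi⟩ := Submodule.exists_finiteIndex_of_cover hcover
  rw [Set.Finite.mem_toFinset] at hp
  have hfin : Finite (N ⧸ p) := AddSubgroup.finite_quotient_of_finiteIndex (H := p.toAddSubgroup)
  have : Nontrivial (N ⧸ p) := Submodule.Quotient.nontrivial_iff.mpr (hs p hp)
  have hne : (maximalIdeal R) • (⊤ : Submodule R (N ⧸ p)) ≠ ⊤ := fun h =>
    top_ne_bot <| Submodule.eq_bot_of_le_smul_of_le_jacobson_bot (maximalIdeal R)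
      (⊤ : Submodule R (N ⧸ p)) Module.Finite.fg_top h.ge (maximalIdeal_le_jacobson _)
  have : Nontrivial ((N ⧸ p) ⧸ (maximalIdeal R) • (⊤ : Submodule R (N ⧸ p))) :=
    Submodule.Quotient.nontrivial_iff.mpr hne
  have : Module (ResidueField R) ((N ⧸ p) ⧸ (maximalIdeal R) • (⊤ : Submodule R (N ⧸ p))) :=
    inferInstanceAs (Module (R ⧸ maximalIdeal R) _)
  have : Infinite ((N ⧸ p) ⧸ (maximalIdeal R) • (⊤ : Submodule R (N ⧸ p))) :=
    Module.Free.infinite (ResidueField R) _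
  have : Finite ((N ⧸ p) ⧸ (maximalIdeal R) • (⊤ : Submodule R (N ⧸ p))) := Quotient.finite _
  exact not_finite ((N ⧸ p) ⧸ (maximalIdeal R) • (⊤ : Submodule R (N ⧸ p)))

/-! ### The Rees algebra and the initial ideal -/

namespace Ideal

variable {R : Type*} [CommRing R]

/-- The degree `n` element `a tⁿ` of the Rees algebra. -/
def reesMonomial (J : Ideal R) (n : ℕ) : ↥(J ^ n) →ₗ[R] reesAlgebra J where
  toFun a := ⟨monomial n a.1, reesAlgebra.monomial_mem.mpr a.2⟩
  map_add' a b := by ext1; simp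
  map_smul' r a := by ext1; simp [smul_monomial]

@[simp]
theorem coe_reesMonomial (J : Ideal R) (n : ℕ) (a : ↥(J ^ n)) :
    (reesMonomial J n a : R[X]) = monomial n a.1 := rfl

/-- The ideal of the Rees algebra of `J` defining the associated graded ring of `R ⧸ I`. -/
def reesInitial (J I : Ideal R) : Ideal (reesAlgebra J) where
  carrier := {f | ∀ n, (f : R[X]).coeff n ∈ J ^ (n + 1) ⊔ I}
  zero_mem' n := by simp
  add_mem' hf hg n := by simpa using add_mem (hf n) (hg n)
  smul_mem' g f hf n := by
    rw [smul_eq_mul, MulMemClass.coe_mul, coeff_mul]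
    refine Submodule.sum_mem _ fun ij hij => ?_
    obtain ⟨u, hu, v, hv, huv⟩ := Submodule.mem_sup.mp (hf ij.2)
    rw [← huv, mul_add]
    refine Submodule.add_mem_sup ?_ (I.mul_mem_left _ hv)
    have := Ideal.mul_mem_mul ((mem_reesAlgebra_iff J _).mp g.2 ij.1) hu
    rwa [← pow_add, ← add_assoc, Finset.HasAntidiagonal.mem_antidiagonal.mp hij] at this

theorem mem_reesInitial {J I : Ideal R} {f : reesAlgebra J} :
    f ∈ reesInitial J I ↔ ∀ n, (f : R[X]).coeff n ∈ J ^ (n + 1) ⊔ I := Iff.rfl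

theorem reesMonomial_mem_reesInitial {J I : Ideal R} {n : ℕ} {a : ↥(J ^ n)} :
    reesMonomial J n a ∈ reesInitial J I ↔ a.1 ∈ J ^ (n + 1) ⊔ I := by
  refine mem_reesInitial.trans ⟨fun h => by simpa using h n, fun h k => ?_⟩
  rw [coe_reesMonomial, coeff_monomial]
  split_ifs with hk
  · exact hk ▸ h
  · exact zero_mem _

theorem reesMonomial_mul (J : Ideal R) (m n : ℕ) (a : ↥(J ^ m)) (b : ↥(J ^ n)) :
    reesMonomial J m a * reesMonomial J n b =
      reesMonomial J (m + n) ⟨a.1 * b.1, by rw [pow_add]; exact Ideal.mul_mem_mul a.2 b.2⟩ := by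
  ext1
  simp [monomial_mul_monomial]

/-- The Rees algebra is generated in degree one. Hence an ideal whose radical contains all of degree
one contains all monomials of large degree. -/
theorem reesMonomial_mem_span_pow (J : Ideal R) (n : ℕ) (a : ↥(J ^ n)) :
    reesMonomial J n a ∈ Ideal.span (Set.range (reesMonomial J 1)) ^ n := by
  induction n with
  | zero => simp
  | succ n ih =>
    obtain ⟨a, ha⟩ := a
    have ha' : a ∈ J ^ n * J ^ 1 := by rwa [← pow_add]
    refine Submodule.mul_induction_on' (C := fun a h => reesMonomial J (n + 1)
      ⟨a, by rwa [pow_add]⟩ ∈ Ideal.span (Set.range (reesMonomial J 1)) ^ (n + 1)) ?_ ?_ ha'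
    · intro b hb c hc
      have := reesMonomial_mul J n 1 ⟨b, hb⟩ ⟨c, hc⟩
      rw [← this, pow_succ]
      exact Ideal.mul_mem_mul (ih ⟨b, hb⟩) (Ideal.subset_span ⟨_, rfl⟩)
    · intro b hb c hc h₁ h₂
      simpa only [← map_add] using! add_mem h₁ h₂

end Ideal

namespace IsLocalRing

variable {R : Type*} [CommRing R] [IsLocalRing R] [IsNoetherianRing R]

/-- An element `x` regular modulo `I` whose initial form avoids the relevant associated primes of
the associated graded ring of `R ⧸ I`. -/
theorem exists_isSMulRegular_and_filter_regular [Infinite (ResidueField R)] (I : Ideal R)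
    (hI : ∃ r ∈ maximalIdeal R, IsSMulRegular (R ⧸ I) r) :
    ∃ x ∈ maximalIdeal R, IsSMulRegular (R ⧸ I) x ∧ ∃ N, ∀ n ≥ N, ∀ a ∈ maximalIdeal R ^ n,
      x * a ∈ maximalIdeal R ^ (n + 2) ⊔ I → a ∈ maximalIdeal R ^ (n + 1) ⊔ I := by
  set m := maximalIdeal R with hm
  obtain ⟨s, hs, hprim⟩ :=
    Submodule.isLasker (R := reesAlgebra m) (M := reesAlgebra m) (Ideal.reesInitial m I)
  -- The submodules of `m` to avoid: degree-one parts of the radicals of the primary components, and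
  -- associated primes of `R ⧸ I`. Components whose radical contains all of degree one cannot be
  -- avoided, but they impose no condition in large degrees.
  let S : Set (Submodule R ↥(m ^ 1)) :=
    {p | p ≠ ⊤ ∧ ∃ q ∈ s, p = ((Ideal.radical q).restrictScalars R).comap (m.reesMonomial 1)} ∪
    {p | ∃ P ∈ associatedPrimes R (R ⧸ I), p = Submodule.comap (m ^ 1).subtype P}
  have hSfin : S.Finite := by
    refine Set.Finite.union ?_ ?_
    · refine (s.finite_toSet.image fun q : Ideal (reesAlgebra m) =>
        ((Ideal.radical q).restrictScalars R).comap (m.reesMonomial 1)).subset ?_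
      rintro p ⟨-, q, hq, rfl⟩
      exact ⟨q, hq, rfl⟩
    · refine ((associatedPrimes.finite R (R ⧸ I)).image fun P =>
        Submodule.comap (m ^ 1).subtype P).subset ?_
      rintro p ⟨P, hP, rfl⟩
      exact ⟨P, hP, rfl⟩
  have hStop : ∀ p ∈ S, p ≠ ⊤ := by
    rintro p (⟨hp, -⟩ | ⟨P, hP, rfl⟩)
    · exact hp
    · obtain ⟨r, hr, hreg⟩ := hI
      intro htop
      have hrP : r ∈ P := by
        have : (⟨r, by simpa using hr⟩ : ↥(m ^ 1)) ∈ Submodule.comap (m ^ 1).subtype P :=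
          htop ▸ Submodule.mem_top
        exact this
      have : r ∈ ⋃ p ∈ associatedPrimes R (R ⧸ I), (p : Set R) := Set.mem_biUnion hP hrP
      rw [biUnion_associatedPrimes_eq_compl_regular] at this
      exact this hreg
  obtain ⟨⟨x, hx1⟩, hx⟩ := exists_notMem_of_ne_top S hSfin hStop
  have hxm : x ∈ m := by simpa using hx1
  have hxreg : IsSMulRegular (R ⧸ I) x := by
    by_contra hreg
    have : x ∈ ({r | IsSMulRegular (R ⧸ I) r}ᶜ : Set R) := hreg
    rw [← biUnion_associatedPrimes_eq_compl_regular] at this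
    obtain ⟨P, hP, hxP⟩ := Set.mem_iUnion₂.mp this
    exact hx _ (Or.inr ⟨P, hP, rfl⟩) hxP
  refine ⟨x, hxm, hxreg, ?_⟩
  have key : ∀ q ∈ s, ∃ N, ∀ n ≥ N, ∀ a : ↥(m ^ n),
      m.reesMonomial n a * m.reesMonomial 1 ⟨x, hx1⟩ ∈ q → m.reesMonomial n a ∈ q := by
    intro q hq
    by_cases htop : ((Ideal.radical q).restrictScalars R).comap (m.reesMonomial 1) = ⊤
    · have hle : Ideal.span (Set.range (m.reesMonomial 1)) ≤ Ideal.radical q := by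
        rw [Ideal.span_le]
        rintro _ ⟨y, rfl⟩
        have : y ∈ ((Ideal.radical q).restrictScalars R).comap (m.reesMonomial 1) :=
          htop ▸ Submodule.mem_top
        exact this
      obtain ⟨N, hN⟩ := Ideal.exists_pow_le_of_le_radical_of_fg hle (IsNoetherian.noetherian _)
      exact ⟨N, fun n hn a _ => hN (Ideal.pow_le_pow_right hn (m.reesMonomial_mem_span_pow n a))⟩
    · refine ⟨0, fun n _ a ha => ?_⟩
      refine ((Ideal.isPrimary_iff.mp (hprim hq)).2 ha).resolve_right fun h => ?_
      exact hx _ (Or.inl ⟨htop, q, hq, rfl⟩) h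
  choose! N hN using key
  refine ⟨s.sup N, fun n hn a ha hxa => ?_⟩
  rw [← Ideal.reesMonomial_mem_reesInitial (a := ⟨a, ha⟩), ← hs, Submodule.mem_finsetInf]
  intro q hq
  refine hN q hq n ((Finset.le_sup hq).trans hn) _ ?_
  have hmem : m.reesMonomial n ⟨a, ha⟩ * m.reesMonomial 1 ⟨x, hx1⟩ ∈ Ideal.reesInitial m I := by
    rw [Ideal.reesMonomial_mul, Ideal.reesMonomial_mem_reesInitial]
    simpa [mul_comm] using hxa
  rw [← hs, Submodule.mem_finsetInf] at hmem
  exact hmem q hq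

/-- Existence of superficial elements. -/
theorem exists_superficial [Infinite (ResidueField R)] (I : Ideal R)
    (hI : ∃ r ∈ maximalIdeal R, IsSMulRegular (R ⧸ I) r) :
    ∃ x ∈ maximalIdeal R, IsSMulRegular (R ⧸ I) x ∧ ∃ N, ∀ n ≥ N, ∀ a,
      x * a ∈ maximalIdeal R ^ (n + 1) ⊔ I → a ∈ maximalIdeal R ^ n ⊔ I := by
  obtain ⟨x, hx, hreg, N, hN⟩ := exists_isSMulRegular_and_filter_regular I hI
  refine ⟨x, hx, hreg, ?_⟩
  set m := maximalIdeal R with hm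
  -- Artin–Rees: for large `n`, `m ^ (n + 1) ⊓ ((x) + I)` lies in `x m ^ N + I`. Cancelling `x`
  -- modulo `I` puts `a` in `m ^ N + I`.
  obtain ⟨k, hk⟩ := Ideal.exists_pow_inf_eq_pow_smul m (Ideal.span {x} ⊔ I)
  refine ⟨N + k, fun n hn a ha => ?_⟩
  have h₀ : a ∈ m ^ N ⊔ I := by
    obtain ⟨b, hb, i, hi, hbi⟩ := Submodule.mem_sup.mp ha
    have hb' : b ∈ m ^ (n + 1) • ⊤ ⊓ (Ideal.span {x} ⊔ I) := by
      refine ⟨by simpa using hb, ?_⟩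
      have : b = x * a - i := by rw [← hbi]; ring
      rw [this]
      exact sub_mem (Ideal.mem_sup_left (Ideal.mul_mem_right _ _ (Ideal.mem_span_singleton_self x)))
        (Ideal.mem_sup_right hi)
    rw [hk _ (by omega)] at hb'
    have hle : m ^ (n + 1 - k) • (m ^ k • ⊤ ⊓ (Ideal.span {x} ⊔ I)) ≤
        Ideal.span {x} * m ^ N ⊔ I := by
      refine (Submodule.smul_mono (Ideal.pow_le_pow_right (by omega : N ≤ n + 1 - k))
        inf_le_right).trans ?_
      rw [smul_eq_mul, Ideal.mul_sup, mul_comm]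
      exact sup_le_sup_left Ideal.mul_le_right _
    obtain ⟨y, hy, j, hj, hyj⟩ := Submodule.mem_sup.mp (hle hb')
    obtain ⟨c, hc, rfl⟩ := Ideal.mem_span_singleton_mul.mp hy
    have hac : a - c ∈ I := by
      refine mem_of_isSMulRegular_quotient_of_smul_mem hreg ?_
      have : x • (a - c) = j + i := by
        rw [smul_eq_mul, mul_sub, ← hbi, ← hyj]; ring
      rw [this]
      exact add_mem hj hi
    have : a = c + (a - c) := by ring
    rw [this]
    exact Submodule.add_mem_sup hc hac
  -- From `m ^ N + I` the element climbs one power at a time by regularity of the initial form.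
  suffices ∀ i, N ≤ i → i ≤ n → a ∈ m ^ i ⊔ I from this n (by omega) le_rfl
  intro i hi
  induction i, hi using Nat.le_induction with
  | base => exact fun _ => h₀
  | succ i hi ih =>
    intro hin
    obtain ⟨b, hb, j, hj, rfl⟩ := Submodule.mem_sup.mp (ih (by omega))
    refine add_mem (hN i hi b hb ?_) (Ideal.mem_sup_right hj)
    have : x * b = x * (b + j) - x * j := by ring
    rw [this]
    exact sub_mem (sup_le_sup_right (Ideal.pow_le_pow_right (by omega)) I ha)
      (Ideal.mem_sup_right (I.mul_mem_left _ hj))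

end IsLocalRing

end

/-! ### Superficial regular sequences and lengths -/

noncomputable section

open IsLocalRing RingTheory.Sequence
open scoped Pointwise

namespace Ideal

variable {R : Type*} [CommRing R]

/-- Multiplication by `x` as a map `R ⧸ K → R ⧸ J`. -/
def quotientMulLeft (x : R) (K J : Ideal R) (h : ∀ a ∈ K, x * a ∈ J) : R ⧸ K →ₗ[R] R ⧸ J :=
  Submodule.mapQ K J (LinearMap.mulLeft R x) h

theorem exact_quotientMulLeft_factor (x : R) (K J : Ideal R) (h : ∀ a ∈ K, x * a ∈ J) :
    Function.Exact (quotientMulLeft x K J h)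
      (Submodule.factor (le_sup_left : J ≤ J ⊔ Ideal.span {x})) := by
  intro y
  obtain ⟨y, rfl⟩ := Submodule.mkQ_surjective J y
  constructor
  · intro hy
    have : y ∈ J ⊔ Ideal.span {x} := by
      exact (Submodule.Quotient.mk_eq_zero _).mp hy
    obtain ⟨j, hj, c, hc, rfl⟩ := Submodule.mem_sup.mp this
    obtain ⟨b, rfl⟩ := Ideal.mem_span_singleton'.mp hc
    refine ⟨Submodule.Quotient.mk b, (Submodule.Quotient.eq J).mpr ?_⟩
    have : x * b - (j + b * x) = -j := by ring
    simpa [this] using! hj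
  · rintro ⟨b, hb⟩
    obtain ⟨b, rfl⟩ := Submodule.mkQ_surjective K b
    rw [← hb]
    refine (Submodule.Quotient.mk_eq_zero _).mpr (Ideal.mem_sup_right ?_)
    exact Ideal.mul_mem_right _ _ (Ideal.mem_span_singleton_self x)

theorem length_quotient_le_add (x : R) (K J : Ideal R) (h : ∀ a ∈ K, x * a ∈ J) :
    Module.length R (R ⧸ J) ≤
      Module.length R (R ⧸ K) + Module.length R (R ⧸ (J ⊔ Ideal.span {x})) := by
  have hex := exact_quotientMulLeft_factor x K J h
  have := Module.length_eq_add_of_exact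
    (LinearMap.ker (Submodule.factor (le_sup_left : J ≤ J ⊔ Ideal.span {x}))).subtype
    (Submodule.factor (le_sup_left : J ≤ J ⊔ Ideal.span {x})) (Submodule.subtype_injective _)
    (Submodule.factor_surjective _) (LinearMap.exact_subtype_ker_map _)
  rw [this, hex.linearMap_ker_eq]
  gcongr
  exact Module.length_le_of_surjective _ (LinearMap.surjective_rangeRestrict _)

theorem length_quotient_eq_add (x : R) (K J : Ideal R) (h : ∀ a, a ∈ K ↔ x * a ∈ J) :
    Module.length R (R ⧸ J) =
      Module.length R (R ⧸ K) + Module.length R (R ⧸ (J ⊔ Ideal.span {x})) := by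
  refine Module.length_eq_add_of_exact (quotientMulLeft x K J fun a => (h a).mp)
    (Submodule.factor (le_sup_left : J ≤ J ⊔ Ideal.span {x})) ?_ (Submodule.factor_surjective _)
    (exact_quotientMulLeft_factor x K J _)
  rw [injective_iff_map_eq_zero]
  intro a ha
  obtain ⟨a, rfl⟩ := Submodule.mkQ_surjective K a
  exact (Submodule.Quotient.mk_eq_zero K).mpr
    ((h a).mpr ((Submodule.Quotient.mk_eq_zero J).mp ha))

/-- `(R ⧸ I) ⧸ x (R ⧸ I)` is `R ⧸ (I + x R)`. -/
def quotSMulTopQuotientEquiv (I : Ideal R) (x : R) :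
    QuotSMulTop x (R ⧸ I) ≃ₗ[R] R ⧸ (I ⊔ Ideal.span {x}) :=
  Submodule.quotEquivOfEq _ (Submodule.map I.mkQ (Ideal.span {x})) (by
    rw [← Submodule.ideal_span_singleton_smul, ← Submodule.range_mkQ I, ← Submodule.map_top,
      ← Submodule.map_smul'', smul_eq_mul, Ideal.mul_top]) ≪≫ₗ
  Submodule.quotientQuotientEquivQuotientSup I (Ideal.span {x})

end Ideal

namespace IsLocalRing

theorem length_quotient_maximalIdeal (R : Type*) [CommRing R] [IsLocalRing R] :
    Module.length R (R ⧸ maximalIdeal R) = 1 :=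
  Module.length_eq_one_iff.mpr (isSimpleModule_iff_isCoatom.mpr (maximalIdeal.isMaximal R).out)

/-- Since `𝔪² ⊆ K`, multiplication by `x ∈ 𝔪` factors through `R ⧸ 𝔪`, so its image in `R ⧸ K` has
length at most one. -/
theorem length_quotient_sup_ofList {R : Type*} [CommRing R] [IsLocalRing R] (K : Ideal R) (hK : maximalIdeal R ^ 2 ≤ K) (rs : List R)
    (hrs : ∀ r ∈ rs, r ∈ maximalIdeal R) :
    Module.length R (R ⧸ K) ≤ rs.length + Module.length R (R ⧸ (K ⊔ Ideal.ofList rs)) := by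
  induction rs generalizing K with
  | nil => rw [Ideal.ofList_nil, sup_bot_eq]; simp
  | cons x rs ih =>
    have hx : x ∈ maximalIdeal R := hrs x (by simp)
    have h₁ := Ideal.length_quotient_le_add x (maximalIdeal R) K fun a ha =>
      hK (by rw [pow_two]; exact Ideal.mul_mem_mul hx ha)
    have h₃ := ih (K ⊔ Ideal.span {x}) (hK.trans le_sup_left) fun r hr => hrs r (by simp [hr])
    rw [Ideal.ofList_cons, ← sup_assoc]
    calc _ ≤ _ := h₁
      _ ≤ 1 + (rs.length + _) := by rw [length_quotient_maximalIdeal R]; gcongr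
      _ = _ := by rw [List.length_cons]; push_cast; ring

variable {R : Type u} [CommRing R] [IsLocalRing R] [IsNoetherianRing R]

/-- Any regular element can begin a regular sequence of the available length. Such lengths are
detected by the vanishing of `Ext^i(R/𝔪, -)`, and the long exact sequence of multiplication by `x`
loses one degree. -/
theorem exists_isRegular_quotSMulTop {M : Type u} [AddCommGroup M] [Module R M]
    [Module.Finite R M] [Nontrivial M] {n : ℕ}
    (h : ∃ rs : List R, rs.length = n + 1 ∧ (∀ r ∈ rs, r ∈ maximalIdeal R) ∧ IsRegular M rs)
    {x : R} (hx : x ∈ maximalIdeal R) (hreg : IsSMulRegular M x) :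
    ∃ rs : List R, rs.length = n ∧ (∀ r ∈ rs, r ∈ maximalIdeal R) ∧
      IsRegular (QuotSMulTop x M) rs := by
  have : Nontrivial (QuotSMulTop x M) := nontrivial_quotSMulTop_of_mem_maximalIdeal M hx
  have hlt (N : Type u) [AddCommGroup N] [Module R N] [Module.Finite R N] [Nontrivial N] :
      maximalIdeal R • (⊤ : Submodule R N) < ⊤ :=
    (Submodule.top_ne_ideal_smul_of_le_jacobson_annihilator
      (maximalIdeal_le_jacobson _)).symm.lt_top
  have hM := ((ModuleCat.exists_isRegular_tfae (maximalIdeal R) (n + 1) (ModuleCat.of R M)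
    (hlt M)).out 3 1).mp h
  refine ((ModuleCat.exists_isRegular_tfae (maximalIdeal R) n (ModuleCat.of R (QuotSMulTop x M))
    (hlt _)).out 1 3).mp fun i hi => ?_
  have zero1 := AddCommGrpCat.isZero_of_iff_subsingleton.mpr (hM i (by omega))
  have zero2 := AddCommGrpCat.isZero_of_iff_subsingleton.mpr (hM (i + 1) (by omega))
  have hS : (ModuleCat.smulShortComplex (ModuleCat.of R M) x).ShortExact :=
    IsSMulRegular.smulShortComplex_shortExact hreg
  exact AddCommGrpCat.subsingleton_of_isZero <| ShortComplex.Exact.isZero_of_both_zeros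
    ((Abelian.Ext.covariant_sequence_exact₃' _ hS) i (i + 1) rfl)
    (zero1.eq_zero_of_src _) (zero2.eq_zero_of_tgt _)

/-- A regular sequence of superficial elements, with the resulting lower bound for the
Hilbert-Samuel function. -/
theorem exists_isWeaklyRegular_and_choose_le_length [Infinite (ResidueField R)] (j : ℕ)
    (I : Ideal R) (hI : I ≠ ⊤)
    (h : ∃ rs : List R, rs.length = j ∧ (∀ r ∈ rs, r ∈ maximalIdeal R) ∧ IsRegular (R ⧸ I) rs) :
    ∃ rs : List R, rs.length = j ∧ (∀ r ∈ rs, r ∈ maximalIdeal R) ∧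
      IsWeaklyRegular (R ⧸ I) rs ∧ ∀ L : ℕ∞,
        (∃ N, ∀ n ≥ N,
          L ≤ Module.length R (R ⧸ (maximalIdeal R ^ n ⊔ (I ⊔ Ideal.ofList rs)))) →
        ∃ N, ∀ k, L * (k.choose j : ℕ) ≤ Module.length R (R ⧸ (maximalIdeal R ^ (N + k) ⊔ I)) := by
  induction j generalizing I with
  | zero =>
    refine ⟨[], rfl, by simp, IsWeaklyRegular.nil R _, ?_⟩
    rintro L ⟨N, hN⟩
    refine ⟨N, fun k => ?_⟩
    have := hN (N + k) (by omega)
    rw [Ideal.ofList_nil, sup_bot_eq] at this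
    simpa using this
  | succ j ih =>
    have : Nontrivial (R ⧸ I) := Ideal.Quotient.nontrivial_iff.mpr hI
    have hr : ∃ r ∈ maximalIdeal R, IsSMulRegular (R ⧸ I) r := by
      obtain ⟨rs, hlen, hmem, hreg⟩ := h
      match rs with
      | [] => simp at hlen
      | r :: rs => exact ⟨r, hmem r (by simp), ((isRegular_cons_iff _ _ _).mp hreg).1⟩
    obtain ⟨x, hx, hreg, n₀, hn₀⟩ := exists_superficial I hr
    have hI' : I ⊔ Ideal.span {x} ≠ ⊤ := by
      refine ne_top_of_le_ne_top (Ideal.IsPrime.ne_top' (I := maximalIdeal R)) ?_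
      exact sup_le (le_maximalIdeal hI) ((Ideal.span_singleton_le_iff_mem _).mpr hx)
    have h' : ∃ rs : List R, rs.length = j ∧ (∀ r ∈ rs, r ∈ maximalIdeal R) ∧
        IsRegular (R ⧸ (I ⊔ Ideal.span {x})) rs := by
      obtain ⟨rs, hlen, hmem, hrs⟩ := exists_isRegular_quotSMulTop h hx hreg
      exact ⟨rs, hlen, hmem,
        ((Ideal.quotSMulTopQuotientEquiv I x).isRegular_congr rs).mp hrs⟩
    obtain ⟨rs, hlen, hmem, hrs, hgrowth⟩ := ih _ hI' h'
    refine ⟨x :: rs, by simp [hlen], by simpa only [List.forall_mem_cons] using ⟨hx, hmem⟩,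
      IsWeaklyRegular.cons hreg
        (((Ideal.quotSMulTopQuotientEquiv I x).isWeaklyRegular_congr rs).mpr hrs), fun L hL => ?_⟩
    rw [Ideal.ofList_cons, ← sup_assoc] at hL
    obtain ⟨N, hN⟩ := hgrowth L hL
    -- Superficiality makes multiplication by `x` injective from `R/(𝔪ⁿ + I)` to `R/(𝔪ⁿ⁺¹ + I)`.
    -- Summing this recursion is Pascal's rule.
    have hstep : ∀ n ≥ n₀, Module.length R (R ⧸ (maximalIdeal R ^ (n + 1) ⊔ I)) =
        Module.length R (R ⧸ (maximalIdeal R ^ n ⊔ I)) +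
          Module.length R (R ⧸ (maximalIdeal R ^ (n + 1) ⊔ (I ⊔ Ideal.span {x}))) := by
      intro n hn
      rw [← sup_assoc]
      refine Ideal.length_quotient_eq_add x _ _ fun a => ⟨fun ha => ?_, hn₀ n hn a⟩
      obtain ⟨b, hb, i, hi, rfl⟩ := Submodule.mem_sup.mp ha
      rw [mul_add, pow_succ']
      exact Submodule.add_mem_sup (Ideal.mul_mem_mul hx hb) (I.mul_mem_left _ hi)
    refine ⟨max N n₀, fun k => ?_⟩
    induction k with
    | zero => simp
    | succ k ihk =>
      rw [← add_assoc, hstep _ (by omega), Nat.choose_succ_succ, add_comm (k.choose j),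
        Nat.cast_add, mul_add]
      refine add_le_add ihk ?_
      -- The bound for the shorter sequence starts at `N`. Evaluating it further out only enlarges
      -- the binomial coefficient.
      have := hN (k + 1 + (max N n₀ - N))
      rw [show N + (k + 1 + (max N n₀ - N)) = max N n₀ + k + 1 by omega] at this
      refine le_trans ?_ this
      gcongr
      omega

theorem length_quotient_maximalIdeal_sq :
    Module.length R (R ⧸ maximalIdeal R ^ 2) =
      (Module.finrank (ResidueField R) (CotangentSpace R) : ℕ) + 1 := by
  have h₁ : Module.length R (maximalIdeal R).Cotangent =
      (Module.finrank (ResidueField R) (CotangentSpace R) : ℕ) := by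
    rw [← Module.length_eq_finrank]
    exact (Module.length_eq_of_surjective (R := ResidueField R) (S := R) (M := CotangentSpace R)
      residue_surjective)
  rw [← h₁, ← length_quotient_maximalIdeal R]
  refine Module.length_eq_add_of_exact (maximalIdeal R).cotangentToQuotientSquare
    (Submodule.factor (Ideal.pow_le_self two_ne_zero)) 
    (Ideal.cotangentToQuotientSquare_injective _) (Submodule.factor_surjective _) ?_
  rw [LinearMap.exact_iff, Ideal.range_cotangentToQuotientSquare, Submodule.factor,
    Submodule.ker_mapQ, Submodule.comap_id]
  rfl

/-- With `ℓ(R/𝔪²) = edim R + 1`, the hypothesis gives `ℓ(R/(rs)) ≤ ℓ(R/(𝔪² + (rs)))`. A proper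
quotient of a module of finite length is strictly shorter, so `𝔪²` vanishes in `R/(rs)`. -/
theorem maximalIdeal_sq_le_of_length_le (rs : List R) (hrs : ∀ r ∈ rs, r ∈ maximalIdeal R)
    [IsArtinian R (R ⧸ Ideal.ofList rs)]
    (h : Module.length R (R ⧸ Ideal.ofList rs) + rs.length ≤
      (Module.finrank (ResidueField R) (CotangentSpace R) : ℕ) + 1) :
    maximalIdeal R ^ 2 ≤ Ideal.ofList rs := by
  have h₁ := length_quotient_sup_ofList _ le_rfl rs hrs
  rw [length_quotient_maximalIdeal_sq] at h₁
  by_contra hle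
  have hne : Submodule.map (Ideal.ofList rs).mkQ (maximalIdeal R ^ 2) ≠ ⊥ := by
    rwa [Ne, ← le_bot_iff, Submodule.map_le_iff_le_comap, Submodule.comap_bot, Submodule.ker_mkQ]
  have hlt := Submodule.length_quotient_lt _ hne
  rw [(Submodule.quotientQuotientEquivQuotientSup (Ideal.ofList rs)
    (maximalIdeal R ^ 2)).length_eq, sup_comm] at hlt
  have := h.trans h₁
  rw [add_comm (rs.length : ℕ∞)] at this
  exact absurd ((ENat.add_le_add_iff_right (ENat.natCast_ne_top _)).mp this) (not_le.mpr hlt)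

end IsLocalRing

end

/-! ### Multiplicity -/

noncomputable section

open IsLocalRing RingTheory.Sequence Filter Topology

theorem Nat.pow_sub_le_factorial_mul_choose (N d n : ℕ) (hn : N + d ≤ n) :
    ((n : ℝ) - (N + d : ℕ)) ^ d ≤ d.factorial * ((n - N).choose d : ℕ) := by
  have h := Nat.pow_sub_le_descFactorial (n - N) d
  rw [Nat.descFactorial_eq_factorial_mul_choose] at h
  have h' : (n - (N + d)) ^ d ≤ d.factorial * (n - N).choose d :=
    (Nat.pow_le_pow_left (by omega) d).trans h
  rw [← Nat.cast_sub hn]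
  exact_mod_cast h'

/-- A function growing at least like `L * (n - N).choose d` has normalized leading coefficient at
least `L`. -/
theorem le_of_tendsto_factorial_mul_div_pow {H : ℕ → ℕ} {L N d : ℕ} {e : ℝ}
    (hH : ∀ k, L * k.choose d ≤ H (N + k))
    (he : Tendsto (fun n : ℕ => (d.factorial : ℝ) * (H n : ℝ) / (n : ℝ) ^ d) atTop (𝓝 e)) :
    (L : ℝ) ≤ e := by
  have hlim : Tendsto (fun n : ℕ => (L : ℝ) * (1 - (N + d : ℕ) * (n : ℝ)⁻¹) ^ d) atTop
      (𝓝 (L * (1 - (N + d : ℕ) * 0) ^ d)) :=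
    (((tendsto_inv_atTop_nhds_zero_nat (𝕜 := ℝ)).const_mul _).const_sub 1 |>.pow d).const_mul _
  rw [mul_zero, sub_zero, one_pow, mul_one] at hlim
  refine le_of_tendsto_of_tendsto hlim he ?_
  filter_upwards [eventually_ge_atTop (N + d + 1)] with n hn
  have hn0 : (0 : ℝ) < n := by exact_mod_cast (by omega : 0 < n)
  have h₁ := Nat.pow_sub_le_factorial_mul_choose N d n (by omega)
  have h₂ : (L : ℝ) * ((n - N).choose d : ℕ) ≤ H n := by
    have := hH (n - N)
    rw [Nat.add_sub_of_le (by omega)] at this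
    exact_mod_cast this
  rw [le_div_iff₀ (by positivity), mul_assoc, ← mul_pow]
  have : (1 - ((N + d : ℕ) : ℝ) * (n : ℝ)⁻¹) * n = n - (N + d : ℕ) := by
    field_simp
  rw [this]
  calc (L : ℝ) * ((n : ℝ) - (N + d : ℕ)) ^ d
      ≤ L * (d.factorial * ((n - N).choose d : ℕ)) := by gcongr
    _ = d.factorial * (L * ((n - N).choose d : ℕ)) := by ring
    _ ≤ _ := by gcongr

namespace LocalAlgebra

variable {R : Type u} [CommRing R] [IsLocalRing R]

/-- A finite supremum of natural numbers is attained. For `d = 0` the empty sequence serves. -/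
theorem exists_isRegular_of_depth_eq {d : ℕ} (h : depth R = d) :
    ∃ rs : List R, rs.length = d ∧ (∀ r ∈ rs, r ∈ maximalIdeal R) ∧ IsRegular R rs := by
  cases d with
  | zero => exact ⟨[], rfl, by simp, IsRegular.nil R R⟩
  | succ d =>
    have hlt : (d : ℕ∞) < depth R := by
      rw [h]
      exact_mod_cast Nat.lt_succ_self d
    obtain ⟨rs, hrs⟩ := lt_iSup_iff.mp hlt
    obtain ⟨hreg, hlt⟩ := lt_iSup_iff.mp hrs
    have hle : (rs.length : ℕ∞) ≤ depth R :=
      le_iSup₂_of_le (f := fun (rs : List R)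
        (_ : IsRegular R rs ∧ ∀ r ∈ rs, r ∈ maximalIdeal R) => (rs.length : ℕ∞)) rs hreg le_rfl
    rw [h] at hle
    have h₁ : d < rs.length := by exact_mod_cast hlt
    have h₂ : rs.length ≤ d + 1 := by exact_mod_cast hle
    exact ⟨rs, by omega, hreg.2, hreg.1⟩

variable [IsNoetherianRing R]

theorem length_quotient_pow_ne_top (n : ℕ) :
    Module.length R (R ⧸ maximalIdeal R ^ n) ≠ ⊤ := by
  have hart : IsArtinianRing (R ⧸ maximalIdeal R ^ n) := by
    by_cases htop : maximalIdeal R ^ n = ⊤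
    · have : Subsingleton (R ⧸ maximalIdeal R ^ n) := Ideal.Quotient.subsingleton_iff.mpr htop
      infer_instance
    have : Nontrivial (R ⧸ maximalIdeal R ^ n) := Ideal.Quotient.nontrivial_iff.mpr htop
    have := IsLocalRing.of_surjective' (Ideal.Quotient.mk (maximalIdeal R ^ n))
      Ideal.Quotient.mk_surjective
    rw [isArtinianRing_iff_isNilpotent_maximalIdeal]
    refine ⟨n, le_bot_iff.mp ?_⟩
    have hle : maximalIdeal (R ⧸ maximalIdeal R ^ n) ≤
        (maximalIdeal R).map (Ideal.Quotient.mk (maximalIdeal R ^ n)) := by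
      intro x hx
      obtain ⟨x, rfl⟩ := Ideal.Quotient.mk_surjective x
      refine Ideal.mem_map_of_mem _ ((mem_maximalIdeal x).mpr fun hu => ?_)
      exact (mem_maximalIdeal _).mp hx (hu.map _)
    refine (Ideal.pow_right_mono hle n).trans ?_
    rw [← Ideal.map_pow, Ideal.map_quotient_self]
  have : IsArtinian R (R ⧸ maximalIdeal R ^ n) :=
    isArtinian_of_surjective_algebraMap (Ideal.Quotient.mk_surjective (I := maximalIdeal R ^ n))
  exact Module.length_ne_top

/-- A Cohen-Macaulay local ring of minimal multiplicity with infinite residue field has a regular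
sequence generating an ideal that contains `𝔪 ^ 2`. -/
theorem exists_isWeaklyRegular_maximalIdeal_sq_le [Infinite (ResidueField R)]
    (hCM : IsCohenMacaulay R) (hmult : HasMinimalMultiplicity R) :
    ∃ rs : List R, (∀ r ∈ rs, r ∈ maximalIdeal R) ∧ IsWeaklyRegular R rs ∧
      maximalIdeal R ^ 2 ≤ Ideal.ofList rs := by
  obtain ⟨d, hd, d', hd', htend⟩ := hmult
  obtain rfl : d' = d := by
    have := hd'.symm.trans hd
    exact_mod_cast this
  have hdepth : depth R = d' := by
    have : (depth R : WithBot ℕ∞) = _ := hCM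
    rw [hd] at this
    exact_mod_cast this
  obtain ⟨ss, hss, hssm, hssreg⟩ := exists_isRegular_of_depth_eq hdepth
  have e : (R ⧸ (⊥ : Ideal R)) ≃ₗ[R] R := Submodule.quotEquivOfEqBot ⊥ rfl
  obtain ⟨rs, hlen, hmem, hreg, hgrowth⟩ := exists_isWeaklyRegular_and_choose_le_length d' ⊥
    bot_ne_top ⟨ss, hss, hssm, (e.isRegular_congr ss).mpr hssreg⟩
  rw [e.isWeaklyRegular_congr] at hreg
  refine ⟨rs, hmem, hreg, ?_⟩
  have hdim := ringKrullDim_add_length_eq_ringKrullDim_of_isRegular rs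
    (IsRegular.of_isWeaklyRegular_of_mem_maximalIdeal (L := R) hmem hreg)
  have hdim0 : ringKrullDim (R ⧸ Ideal.ofList rs) ≤ 0 := by
    rw [hd, hlen] at hdim
    generalize ringKrullDim (R ⧸ Ideal.ofList rs) = t at hdim
    induction t with
    | bot => exact bot_le
    | coe t =>
      have ht : t + d' = d' := by exact_mod_cast hdim
      have : t = 0 := by
        induction t with
        | top => simp at ht
        | coe t =>
          have : t + d' = d' := by exact_mod_cast ht
          exact_mod_cast (by omega : t = 0)
      simp [this]
  have : Ring.KrullDimLE 0 (R ⧸ Ideal.ofList rs) := Ring.krullDimLE_iff.mpr hdim0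
  have hart : IsArtinianRing (R ⧸ Ideal.ofList rs) := isArtinianRing_iff_krullDimLE_zero.mpr this
  have hartR : IsArtinian R (R ⧸ Ideal.ofList rs) :=
    isArtinian_of_surjective_algebraMap (Ideal.Quotient.mk_surjective (I := Ideal.ofList rs))
  obtain ⟨N, hN⟩ := exists_maximalIdeal_pow_le_of_isArtinianRing_quotient (Ideal.ofList rs)
  obtain ⟨L, hL⟩ := ENat.ne_top_iff_exists.mp 
    (Module.length_ne_top (R := R) (M := R ⧸ Ideal.ofList rs))
  -- Since `𝔪 ^ N ⊆ (rs)`, the quotients by `𝔪 ^ n + (rs)` all have length `L` once `n ≥ N`.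
  obtain ⟨N', hN'⟩ := hgrowth L ⟨N, fun n hn => by
    rw [bot_sup_eq, sup_eq_right.mpr ((Ideal.pow_le_pow_right hn).trans hN), hL]⟩
  have hle : (L : ℝ) ≤ (embDim R : ℝ) - d' + 1 := by
    refine le_of_tendsto_factorial_mul_div_pow (N := N') (fun k => ?_) htend
    have := hN' k
    rw [sup_bot_eq] at this
    rw [hilbertSamuel]
    have h := ENat.toNat_le_toNat this (length_quotient_pow_ne_top _)
    exact_mod_cast h
  refine maximalIdeal_sq_le_of_length_le rs hmem ?_
  rw [← hL, hlen]
  have : L + d' ≤ embDim R + 1 := by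
    have : (L : ℝ) + d' ≤ embDim R + 1 := by linarith
    exact_mod_cast this
  exact_mod_cast this

end LocalAlgebra

end

/-! ### Thick subcategories containing the residue field -/

noncomputable section

open IsLocalRing RingTheory.Sequence
open scoped Pointwise

namespace ThickSubcategory

variable {R : Type u} [CommRing R] [IsNoetherianRing R]

/-- The short complex of finitely generated modules given by an exact sequence of linear maps. -/
def fgShortComplex {A B C : Type u} [AddCommGroup A] [Module R A] [Module.Finite R A]
    [AddCommGroup B] [Module R B] [Module.Finite R B]
    [AddCommGroup C] [Module R C] [Module.Finite R C]
    (f : A →ₗ[R] B) (g : B →ₗ[R] C) (h : Function.Exact f g) :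
    ShortComplex (FGModuleCat.{u} R) where
  X₁ := FGModuleCat.of R A
  X₂ := FGModuleCat.of R B
  X₃ := FGModuleCat.of R C
  f := FGModuleCat.ofHom f
  g := FGModuleCat.ofHom g
  zero := by
    ext x
    exact h.apply_apply_eq_zero x

theorem shortExact_fgShortComplex {A B C : Type u} [AddCommGroup A] [Module R A]
    [Module.Finite R A] [AddCommGroup B] [Module R B] [Module.Finite R B]
    [AddCommGroup C] [Module R C] [Module.Finite R C]
    (f : A →ₗ[R] B) (g : B →ₗ[R] C) (h : Function.Exact f g) (hf : Function.Injective f)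
    (hg : Function.Surjective g) : (fgShortComplex f g h).ShortExact := by
  have : ((fgShortComplex f g h).map (forget₂ (FGModuleCat R) (ModuleCat R))).ShortExact :=
    ModuleCat.shortComplex_shortExact _ h hf hg
  have hm := this.mono_f
  have he := this.epi_g
  exact
    { exact := ((fgShortComplex f g h).exact_map_iff_of_faithful (forget₂ _ _)).mp this.exact
      mono_f := (forget₂ (FGModuleCat R) (ModuleCat R)).mono_of_mono_map hm
      epi_g := (forget₂ (FGModuleCat R) (ModuleCat R)).epi_of_epi_map he }

variable {Q : ObjectProperty (FGModuleCat.{u} R)}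

section

variable {A B C : Type u} [AddCommGroup A] [Module R A] [Module.Finite R A] [AddCommGroup B]
  [Module R B] [Module.Finite R B] [AddCommGroup C] [Module R C] [Module.Finite R C]

theorem IsThick.of_linearRetract (hQ : IsThick Q) (i : A →ₗ[R] B) (r : B →ₗ[R] A)
    (h : r ∘ₗ i = LinearMap.id) (hB : Q (FGModuleCat.of R B)) : Q (FGModuleCat.of R A) :=
  hQ.of_retract
    { i := FGModuleCat.ofHom i
      r := FGModuleCat.ofHom r
      retract := by
        ext x
        exact LinearMap.congr_fun h x } hB

theorem IsThick.of_linearEquiv (hQ : IsThick Q) (e : A ≃ₗ[R] B) (hB : Q (FGModuleCat.of R B)) :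
    Q (FGModuleCat.of R A) :=
  hQ.of_linearRetract e.toLinearMap e.symm.toLinearMap (by ext; simp) hB

theorem IsThick.quotSMulTop (hQ : IsThick Q) {x : R} (hx : IsSMulRegular A x)
    (hA : Q (FGModuleCat.of R A)) : Q (FGModuleCat.of R (QuotSMulTop x A)) :=
  hQ.right (shortExact_fgShortComplex (LinearMap.lsmul R A x) (Submodule.mkQ _)
    (LinearMap.exact_lsmul_mkQ_smul_top A x) hx (Submodule.mkQ_surjective _)) hA hA

end

theorem IsThick.quotient_ofList (hQ : IsThick Q) {A : Type u} [AddCommGroup A] [Module R A]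
    [Module.Finite R A] (rs : List R) (hrs : IsWeaklyRegular A rs)
    (hA : Q (FGModuleCat.of R A)) :
    Q (FGModuleCat.of R (A ⧸ Ideal.ofList rs • (⊤ : Submodule R A))) := by
  induction rs generalizing A with
  | nil =>
    refine hQ.of_linearEquiv (Submodule.quotEquivOfEqBot _ ?_) hA
    rw [Ideal.ofList_nil, Submodule.bot_smul]
  | cons x rs ih =>
    obtain ⟨hx, hrs⟩ := (isWeaklyRegular_cons_iff _ _ _).mp hrs
    exact hQ.of_linearEquiv (Submodule.quotOfListConsSMulTopEquivQuotSMulTopInner A x rs)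
      (ih hrs (hQ.quotSMulTop hx hA))

theorem IsThick.pi_fin (hQ : IsThick Q) (hR : Q (FGModuleCat.of R R)) (n : ℕ) :
    Q (FGModuleCat.of R (Fin n → R)) := by
  induction n with
  | zero =>
    -- The zero module is a retract of `R`.
    exact hQ.of_linearRetract 0 0 (Subsingleton.elim _ _) hR
  | succ n ih =>
    have e : (Fin (n + 1) → R) ≃ₗ[R] R × (Fin n → R) := (Fin.consLinearEquiv R fun _ => R).symm
    refine hQ.of_linearEquiv e ?_
    exact hQ.middle (shortExact_fgShortComplex (LinearMap.inl R R (Fin n → R))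
      (LinearMap.snd R R (Fin n → R)) Function.Exact.inl_snd LinearMap.inl_injective
      LinearMap.snd_surjective) hR ih

end ThickSubcategory

/-! ### Minimal covers, syzygies and regular sequences -/

namespace IsLocalRing

/-- Minimal free covers of finitely generated modules over a local ring. -/
theorem exists_surjective_ker_le_smul {R N : Type*} [CommRing R] [IsLocalRing R] [AddCommGroup N]
    [Module R N] [Module.Finite R N] :
    ∃ (n : ℕ) (g : (Fin n → R) →ₗ[R] N), Function.Surjective g ∧
      LinearMap.ker g ≤ maximalIdeal R • ⊤ := by
  classical
  -- The rank is taken least possible: a relation with a unit coordinate would make one generator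
  -- redundant.
  have hex : ∃ n, ∃ g : (Fin n → R) →ₗ[R] N, Function.Surjective g := Module.Finite.exists_fin' R N
  obtain ⟨g, hg⟩ := Nat.find_spec hex
  refine ⟨_, g, hg, fun v hv => ?_⟩
  by_cases hmem : ∀ i, v i ∈ maximalIdeal R
  · rw [pi_eq_sum_univ' v]
    exact Submodule.sum_mem _ fun i _ => Submodule.smul_mem_smul (hmem i) Submodule.mem_top
  · exfalso
    push Not at hmem
    obtain ⟨i, hi⟩ := hmem
    have hu : IsUnit (v i) := by simpa using hi
    obtain ⟨c, hc⟩ := hu.exists_right_inv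
    have hmin := fun m => Nat.find_min hex (m := m)
    generalize Nat.find hex = n at *
    cases n with
    | zero => exact i.elim0
    | succ n =>
      refine hmin n n.lt_succ_self
        ⟨Fintype.linearCombination R fun j => g (Pi.single (i.succAbove j) 1), fun y => ?_⟩
      obtain ⟨w, rfl⟩ := hg y
      -- Subtracting a multiple of the relation `v` clears coordinate `i` without changing the image
      -- under `g`.
      refine ⟨fun j => (w - (w i * c) • v) (i.succAbove j), ?_⟩
      have h₀ : (w - (w i * c) • v) i = 0 := by
        simp only [Pi.sub_apply, Pi.smul_apply, smul_eq_mul]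
        linear_combination -(w i) * hc
      have h₁ : g w = g (w - (w i * c) • v) := by
        rw [map_sub, map_smul, LinearMap.mem_ker.mp hv, smul_zero, sub_zero]
      rw [h₁, Fintype.linearCombination_apply]
      conv_rhs => rw [pi_eq_sum_univ' (w - (w i * c) • v), map_sum, Fin.sum_univ_succAbove _ i, h₀]
      simp only [map_smul, zero_smul, map_zero, zero_add]

end IsLocalRing

section ProjectiveDimension

variable {R : Type u} [CommRing R] {F N : Type u} [AddCommGroup F] [Module R F]
  [Module.Projective R F] [AddCommGroup N] [Module R N]

theorem projectiveDimension_ker_eq_top (g : F →ₗ[R] N) (hg : Function.Surjective g)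
    (hN : projectiveDimension (ModuleCat.of R N) = ⊤) :
    projectiveDimension (ModuleCat.of R (LinearMap.ker g)) = ⊤ := by
  by_contra hne
  obtain ⟨n, hn⟩ := (projectiveDimension_ne_top_iff _).mp hne
  have hS := ModuleCat.shortComplex_shortExact
    (ModuleCat.shortComplexOfCompEqZero (LinearMap.ker g).subtype g
      (LinearMap.exact_subtype_ker_map g).linearMap_comp_eq_zero)
    (LinearMap.exact_subtype_ker_map g) (Submodule.subtype_injective _) hg
  have : Projective (ModuleCat.of R F) := (IsProjective.iff_projective F).mp inferInstance
  have h := hS.hasProjectiveDimensionLT_X₃ (n + 1) hn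
    (hasProjectiveDimensionLT_of_ge (ModuleCat.of R F) 1 (n + 2) (by omega))
  exact (projectiveDimension_ne_top_iff (ModuleCat.of R N)).mpr ⟨n + 1, h⟩ hN

end ProjectiveDimension

namespace RingTheory.Sequence

variable {R : Type*} [CommRing R]

/-- Reduction modulo a sequence regular on the cokernel `N` keeps `0 → ker g → F → N → 0` exact on
the left. -/
theorem quotient_ker_map_injective {F N : Type*} [AddCommGroup F] [Module R F] [AddCommGroup N]
    [Module R N] (g : F →ₗ[R] N) (hg : Function.Surjective g) {rs : List R}
    (hN : IsWeaklyRegular N rs) :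
    Function.Injective (Submodule.mapQ _ _ _
      (Submodule.smul_top_le_comap_smul_top (Ideal.ofList rs) (LinearMap.ker g).subtype)) := by
  have hex := map_first_exact_on_four_term_right_exact_of_isSMulRegular_last
    (f₁ := (0 : PUnit.{1} →ₗ[R] LinearMap.ker g)) (f₂ := (LinearMap.ker g).subtype) (f₃ := g)
    ((LinearMap.exact_zero_iff_injective _ _).mpr (Submodule.subtype_injective _))
    (LinearMap.exact_subtype_ker_map g) hg hN
  rw [← LinearMap.ker_eq_bot, hex.linearMap_ker_eq, LinearMap.range_eq_bot]
  ext x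
  simp

/-- At each stage the reduced kernel embeds in the reduced `F`, and regularity of the next element
passes to submodules. -/
theorem isWeaklyRegular_ker {F N : Type*} [AddCommGroup F] [Module R F] [AddCommGroup N]
    [Module R N] (g : F →ₗ[R] N) (hg : Function.Surjective g) {rs : List R}
    (hF : IsWeaklyRegular F rs) (hN : IsWeaklyRegular N rs) :
    IsWeaklyRegular (LinearMap.ker g) rs := by
  induction rs using List.reverseRecOn with
  | nil => exact IsWeaklyRegular.nil R _
  | append_singleton rs x ih =>
    have hF' := ((isWeaklyRegular_append_iff _ _ _).mp hF).1
    have hN' := ((isWeaklyRegular_append_iff _ _ _).mp hN).1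
    rw [isWeaklyRegular_append_iff, isWeaklyRegular_singleton_iff] at hF ⊢
    exact ⟨ih hF' hN', hF.2.of_injective _ (quotient_ker_map_injective g hg hN')⟩

theorem isWeaklyRegular_fin_fun {rs : List R} (hrs : IsWeaklyRegular R rs) (n : ℕ) :
    IsWeaklyRegular (Fin n → R) rs :=
  ((TensorProduct.rid R (Fin n → R)).isWeaklyRegular_congr rs).mp hrs.isWeaklyRegular_lTensor

/-- Passing to a syzygy extends a regular sequence. -/
theorem isWeaklyRegular_ker_append {F N : Type*} [AddCommGroup F] [Module R F] [AddCommGroup N]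
    [Module R N] (g : F →ₗ[R] N) (hg : Function.Surjective g) {rs : List R} {x : R}
    (hF : IsWeaklyRegular F (rs ++ [x])) (hN : IsWeaklyRegular N rs) :
    IsWeaklyRegular (LinearMap.ker g) (rs ++ [x]) := by
  rw [isWeaklyRegular_append_iff, isWeaklyRegular_singleton_iff] at hF ⊢
  exact ⟨isWeaklyRegular_ker g hg hF.1 hN, hF.2.of_injective _ (quotient_ker_map_injective g hg hN)⟩

end RingTheory.Sequence

/-! ### Syzygies in thick subcategories and the residue field -/

namespace ThickSubcategory

variable {R : Type u} [CommRing R] [IsNoetherianRing R] {Q : ObjectProperty (FGModuleCat.{u} R)}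

theorem IsThick.ker (hQ : IsThick Q) (hR : Q (FGModuleCat.of R R)) {n : ℕ} {N : Type u}
    [AddCommGroup N] [Module R N] [Module.Finite R N] (g : (Fin n → R) →ₗ[R] N)
    (hg : Function.Surjective g) (hN : Q (FGModuleCat.of R N)) :
    Q (FGModuleCat.of R (LinearMap.ker g)) :=
  hQ.left (shortExact_fgShortComplex (LinearMap.ker g).subtype g
    (LinearMap.exact_subtype_ker_map g) (Submodule.subtype_injective _) hg) (hQ.pi_fin hR n) hN

/-- High syzygies: given a regular sequence on `R`, a thick subcategory containing `R` and a module
of infinite projective dimension contains such a module on which the sequence is regular. -/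
theorem IsThick.exists_isWeaklyRegular (hQ : IsThick Q) (hR : Q (FGModuleCat.of R R))
    (h : ∃ (N : Type u) (_ : AddCommGroup N) (_ : Module R N) (_ : Module.Finite R N),
      Q (FGModuleCat.of R N) ∧ projectiveDimension (ModuleCat.of R N) = ⊤)
    (rs : List R) (hrs : IsWeaklyRegular R rs) :
    ∃ (N : Type u) (_ : AddCommGroup N) (_ : Module R N) (_ : Module.Finite R N),
      Q (FGModuleCat.of R N) ∧ projectiveDimension (ModuleCat.of R N) = ⊤ ∧
        IsWeaklyRegular N rs := by
  induction rs using List.reverseRecOn with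
  | nil =>
    obtain ⟨N, _, _, _, hN, hpd⟩ := h
    exact ⟨N, _, _, ‹_›, hN, hpd, IsWeaklyRegular.nil R _⟩
  | append_singleton rs x ih =>
    obtain ⟨N, _, _, _, hN, hpd, hreg⟩ := ih ((isWeaklyRegular_append_iff _ _ _).mp hrs).1
    obtain ⟨n, g, hg⟩ := Module.Finite.exists_fin' R N
    exact ⟨LinearMap.ker g, _, _, inferInstance, hQ.ker hR g hg hN,
      projectiveDimension_ker_eq_top g hg hpd,
      isWeaklyRegular_ker_append g hg (isWeaklyRegular_fin_fun hrs n) hreg⟩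

variable [IsLocalRing R]

/-- A nonzero finitely generated module killed by the maximal ideal has the residue field as a
direct summand. -/
theorem IsThick.residueField_of_smul_eq_zero (hQ : IsThick Q) {V : Type u} [AddCommGroup V]
    [Module R V] [Module.Finite R V] [Nontrivial V]
    (hV : ∀ r ∈ maximalIdeal R, ∀ v : V, r • v = 0) (h : Q (FGModuleCat.of R V)) :
    Q (FGModuleCat.of R (ResidueField R)) := by
  have htors : Module.IsTorsionBySet R V (maximalIdeal R) := fun v r => hV r r.2 v
  let _ : Module (ResidueField R) V := htors.module
  have : IsScalarTower R (ResidueField R) V := htors.isScalarTower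
  obtain ⟨v, hv⟩ := exists_ne (0 : V)
  obtain ⟨r, hr⟩ := LinearMap.exists_leftInverse_of_injective
    (LinearMap.toSpanSingleton (ResidueField R) V v)
    (LinearMap.ker_toSpanSingleton (ResidueField R) hv)
  exact hQ.of_linearRetract ((LinearMap.toSpanSingleton (ResidueField R) V v).restrictScalars R)
    (r.restrictScalars R) (LinearMap.ext fun x => LinearMap.congr_fun hr x) h

/-- If `𝔪 ^ 2` lies in an ideal generated by a regular sequence, then a thick subcategory containing
`R` and a module of infinite projective dimension contains the residue field. -/
theorem IsThick.residueField_mem (hQ : IsThick Q) (hR : Q (FGModuleCat.of R R))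
    (h : ∃ (N : Type u) (_ : AddCommGroup N) (_ : Module R N) (_ : Module.Finite R N),
      Q (FGModuleCat.of R N) ∧ projectiveDimension (ModuleCat.of R N) = ⊤)
    (rs : List R) (hmem : ∀ r ∈ rs, r ∈ maximalIdeal R) (hrs : IsWeaklyRegular R rs)
    (hsq : maximalIdeal R ^ 2 ≤ Ideal.ofList rs) :
    Q (FGModuleCat.of R (ResidueField R)) := by
  obtain ⟨N, _, _, _, hN, hpd, hreg⟩ := hQ.exists_isWeaklyRegular hR h rs hrs
  obtain ⟨n, g, hg, hker⟩ := exists_surjective_ker_le_smul (R := R) (N := N)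
  have hK := isWeaklyRegular_ker g hg (isWeaklyRegular_fin_fun hrs n) hreg
  -- The kernel has infinite projective dimension, whereas the zero module has projective dimension
  -- `⊥`.
  have hnt : Nontrivial (LinearMap.ker g) := by
    by_contra hnt
    rw [not_nontrivial_iff_subsingleton] at hnt
    have htop := projectiveDimension_ker_eq_top g hg hpd
    rw [(projectiveDimension_eq_bot_iff _).mpr
      (ModuleCat.isZero_of_subsingleton (ModuleCat.of R (LinearMap.ker g)))] at htop
    exact absurd htop (by simp)
  have : Nontrivial (LinearMap.ker g ⧸ Ideal.ofList rs • (⊤ : Submodule R (LinearMap.ker g))) :=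
    (IsRegular.of_isWeaklyRegular_of_mem_maximalIdeal _ hmem hK).quot_ofList_smul_nontrivial ⊤
  refine hQ.residueField_of_smul_eq_zero ?_ (hQ.quotient_ofList rs hK (hQ.ker hR g hg hN))
  intro r hr v
  obtain ⟨⟨v, hv⟩, rfl⟩ := Submodule.mkQ_surjective _ v
  -- Vanishing is tested in `F/(rs)F`, where minimality of the cover puts `r • v` in `𝔪²F ⊆ (rs)F`.
  refine quotient_ker_map_injective g hg hreg ?_
  rw [map_zero]
  refine (Submodule.Quotient.mk_eq_zero _).mpr ?_
  have : r • v ∈ (maximalIdeal R ^ 2) • (⊤ : Submodule R (Fin n → R)) := by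
    rw [pow_two, ← smul_eq_mul, Submodule.smul_assoc]
    exact Submodule.smul_mem_smul hr (hker hv)
  exact Submodule.smul_mono_left hsq this

end ThickSubcategory

end

theorem mainTheorem11 (R : Type u) [CommRing R] [IsLocalRing R] [IsNoetherianRing R]
    (hCM : LocalAlgebra.IsCohenMacaulay R)
    (hGor : ¬ LocalAlgebra.IsGorenstein R)
    (hmult : LocalAlgebra.HasMinimalMultiplicity R)
    (hk : Infinite (IsLocalRing.ResidueField R))
    (M : FGModuleCat.{u} R)
    (hM : projectiveDimension M.obj = ⊤) :
    ThickSubcategory.thickClosure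
      (ObjectProperty.pair (FGModuleCat.of R R) M)
      (FGModuleCat.of R (IsLocalRing.ResidueField R)) := by
  obtain ⟨rs, hmem, hrs, hsq⟩ :=
    LocalAlgebra.exists_isWeaklyRegular_maximalIdeal_sq_le hCM hmult
  have hle := ThickSubcategory.le_thickClosure (ObjectProperty.pair (FGModuleCat.of R R) M)
  exact (ThickSubcategory.isThick_thickClosure _).residueField_mem
    (hle _ (by simp)) ⟨M, _, _, inferInstance, hle M (by simp), hM⟩ rs hmem hrs hsq
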